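/- Let $R\in(0,\infty)\setminus\{1\}$ (risk aversion), let $\lambda\ge 0$ and $\gamma\in[0,1)$ with $\lambda+\gamma>0$ (proportional transaction costs on purchases and sales of the illiquid asset), and put $\xi=\frac{\lambda+\gamma}{1-\gamma}$. For auxiliary parameters $b_1>0$, $b_2>1$, $b_3>0$ define $$m(q)=\frac{R(1-R)}{b_1}q^2-\frac{b_3(1-R)}{b_1}q+1,\qquad \ell(q)=m(q)+\frac{1-R}{b_1}q(1-q)+\frac{(b_2-1)R(1-R)}{b_1}\,\frac{q}{(1-R)q+R},$$ $$\varphi(q,n)=b_1(n-1)+(1-R)(b_3-2R)q+(2-b_2)R(1-R),\qquad E(q)^2=4R^2(1-R)^2(b_2-1)(1-q)^2,$$ $$\Delta(q,n)=2(1-R)(1-q)\big[(1-R)q+R\big]-\varphi(q,n)-\operatorname{sgn}(1-R)\sqrt{\varphi(q,n)^2+E(q)^2},$$ $$O(q,n)=\frac{(1-R)n}{R(1-q)}-\frac{2(1-R)^2\,q\,n/R}{\Delta(q,n)}\qquad (q\neq 1,\ \Delta(q,n)\neq 0),$$ extended by continuity to $q=1$ for $n>0$, $(1-R)n<(1-R)\ell(1)$,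 where $O(1,n)=-n\,\frac{(1-R)(n-m(1))}{\ell(1)-n}$. A solution of the free boundary value problem is a triple $(n,q_*,q^*)$ with $0<q_*<q^*$ and a positive function $n$ on $[q_*,q^*]$ whose graph lies in the set where $O$ is defined, such that $$n'(q)=O(q,n(q))\ \text{ for } q\in[q_*,q^*],\qquad n(q_*)=m(q_*),\quad n(q^*)=m(q^*),$$ $$\ln(1+\xi)=\int_{q_*}^{q^*}\left(-\frac{R}{q(1-R)}\,\frac{O(q,n(q))}{n(q)}\right)dq .$$ The corresponding purchase and sale boundaries of the no-transaction interval $[p_*,p^*]$ are $$p_*=\frac{q_*}{1+\lambda(1-q_*)},\qquad p^*=\frac{q^*}{1-\gamma(1-q^*)} .$$ **Theorem.** Whenever solutions of the free boundary value problem exist for the two parameter sets that are compared: 1. $p_*$ and $p^*$ are (strictly) decreasing in $b_1$, the quantities $R,b_2,b_3,\lambda,\gamma$ being fixed. 2. If $R<1$, then $p_*$ and $p^*$ are (strictly) increasing in $b_3$, the quantities $R,b_1,b_2,\lambda,\gamma$ being fixed. -/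

import Mathlib

/-- The functions of the free boundary value problem depend on the risk aversion `R` and on the
auxiliary parameters `b₁`, `b₂`, `b₃`. -/
structure AuxParams where
  R : ℝ
  b₁ : ℝ
  b₂ : ℝ
  b₃ : ℝ

namespace AuxParams

/-- Standing assumptions on the parameters. -/
structure Valid (P : AuxParams) : Prop where
  R_pos : 0 < P.R
  R_ne_one : P.R ≠ 1
  b₁_pos : 0 < P.b₁
  one_lt_b₂ : 1 < P.b₂
  b₃_pos : 0 < P.b₃

/-- The quadratic `m`. -/
noncomputable def m (P : AuxParams) (q : ℝ) : ℝ :=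
  P.R * (1 - P.R) / P.b₁ * q ^ 2 - P.b₃ * (1 - P.R) / P.b₁ * q + 1

/-- The algebraic function `ℓ`. -/
noncomputable def ell (P : AuxParams) (q : ℝ) : ℝ :=
  P.m q + (1 - P.R) / P.b₁ * q * (1 - q)
    + (P.b₂ - 1) * P.R * (1 - P.R) / P.b₁ * (q / ((1 - P.R) * q + P.R))

noncomputable def phi (P : AuxParams) (q n : ℝ) : ℝ :=
  P.b₁ * (n - 1) + (1 - P.R) * (P.b₃ - 2 * P.R) * q + (2 - P.b₂) * P.R * (1 - P.R)

/-- The function `E(q)²`. -/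
noncomputable def Esq (P : AuxParams) (q : ℝ) : ℝ :=
  4 * P.R ^ 2 * (1 - P.R) ^ 2 * (P.b₂ - 1) * (1 - q) ^ 2

/-- The denominator in the definition of `O(q, n)`. -/
noncomputable def den (P : AuxParams) (q n : ℝ) : ℝ :=
  2 * (1 - P.R) * (1 - q) * ((1 - P.R) * q + P.R) - P.phi q n
    - Real.sign (1 - P.R) * Real.sqrt (P.phi q n ^ 2 + P.Esq q)

/-- The points `(q, n)` at which the right-hand side `O(q, n)` is defined: for `q ≠ 1` those at which
the denominator in its formula does not vanish, and for `q = 1` those to which it extends by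
continuity. -/
def ODomain (P : AuxParams) (q n : ℝ) : Prop :=
  (q ≠ 1 ∧ P.den q n ≠ 0) ∨ (q = 1 ∧ (1 - P.R) * n < (1 - P.R) * P.ell 1)

open Classical in
/-- The right-hand side `O(q, n)` of the differential equation `n' = O(q, n)`. Its value at `q = 1` is
the limit as `q → 1`, which exists for `(1 - R) n < (1 - R) ℓ(1)`. -/
noncomputable def O (P : AuxParams) (q n : ℝ) : ℝ :=
  if q = 1 then
    n * (-((1 - P.R) * (n - P.m 1)) / (P.ell 1 - n))
  else
    (1 - P.R) * n / (P.R * (1 - q)) - (2 * (1 - P.R) ^ 2 * q * n / P.R) / P.den q n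

end AuxParams

/-- The round-trip transaction cost for proportional costs `lam` on purchases and `gam` on sales. -/
noncomputable def roundTrip (lam gam : ℝ) : ℝ := (lam + gam) / (1 - gam)

/-- `(n, qL, qU)` solves the free boundary value problem with parameters `P` and round-trip
transaction cost `ξ`. Only the values of `n` on `[qL, qU]` matter. -/
structure IsFreeBoundarySolution (P : AuxParams) (ξ : ℝ) (n : ℝ → ℝ) (qL qU : ℝ) : Prop where
  qL_pos : 0 < qL
  qL_lt_qU : qL < qU
  pos : ∀ q ∈ Set.Icc qL qU, 0 < n q
  mem_domain : ∀ q ∈ Set.Icc qL qU, P.ODomain q (n q)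
  ode : ∀ q ∈ Set.Icc qL qU, HasDerivWithinAt n (P.O q (n q)) (Set.Icc qL qU) q
  left_boundary : n qL = P.m qL
  right_boundary : n qU = P.m qU
  cost : Real.log (1 + ξ) = ∫ q in qL..qU, -(P.R / (q * (1 - P.R)) * (P.O q (n q) / n q))

/-- The purchase boundary `p_*` corresponding to the left boundary point `q_*`. -/
noncomputable def purchaseBoundary (lam qL : ℝ) : ℝ := qL / (1 + lam * (1 - qL))

/-- The sale boundary `p^*` corresponding to the right boundary point `q^*`. -/
noncomputable def saleBoundary (gam qU : ℝ) : ℝ := qU / (1 - gam * (1 - qU))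

open Set

/-- Comparison for the linear equation `d' = ρ d + σ` with a positive source term `σ`. -/
theorem linear_ode_sign {d ρ σ : ℝ → ℝ} {s t : ℝ}
    (hd : ∀ x ∈ Icc s t, HasDerivWithinAt d (ρ x * d x + σ x) (Icc s t) x)
    (hρ : ContinuousOn ρ (Icc s t)) (hσ : ∀ x ∈ Ioo s t, 0 < σ x) :
    (0 ≤ d s → ∀ x ∈ Ioc s t, 0 < d x) ∧ (d t ≤ 0 → ∀ x ∈ Ico s t, d x < 0) := by
  rcases le_or_gt t s with hts | hst
  · exact ⟨fun _ x hx => absurd (hx.1.trans_le hx.2) hts.not_gt,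
      fun _ x hx => absurd (hx.1.trans_lt hx.2) hts.not_gt⟩
  obtain ⟨r, hrc, hr⟩ : ∃ r : ℝ → ℝ, Continuous r ∧ ∀ x ∈ Icc s t, r x = ρ x :=
    ⟨IccExtend hst.le ((Icc s t).domRestrict ρ), hρ.domRestrict.Icc_extend', fun x hx => by
      rw [IccExtend_of_mem _ _ hx]; rfl⟩
  set I : ℝ → ℝ := fun x => ∫ y in s..x, r y with hI
  have hId : ∀ x, HasDerivAt I (r x) x := fun x =>
    intervalIntegral.integral_hasDerivAt_right (hrc.intervalIntegrable _ _)
      (hrc.stronglyMeasurableAtFilter _ _) hrc.continuousAt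
  have hmono : StrictMonoOn (fun x => d x * Real.exp (-I x)) (Icc s t) := by
    refine strictMonoOn_of_deriv_pos (convex_Icc s t) ?_ ?_
    · refine ContinuousOn.mul (fun x hx => (hd x hx).continuousWithinAt) ?_
      exact (Real.continuous_exp.comp (continuous_iff_continuousAt.2
        fun x => (hId x).continuousAt).neg).continuousOn
    · intro x hx
      rw [interior_Icc] at hx
      have h1 := (hd x (Ioo_subset_Icc_self hx)).hasDerivAt (Icc_mem_nhds hx.1 hx.2)
      have h2 := h1.mul (hId x).neg.exp
      have h3 := hσ x hx
      have : deriv (fun x => d x * Real.exp (-I x)) x = σ x * Real.exp (-I x) := by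
        refine (HasDerivAt.deriv h2).trans ?_
        simp only [Pi.neg_apply]
        rw [hr x (Ioo_subset_Icc_self hx)]
        ring
      rw [this]
      positivity
  constructor
  · intro h0 x hx
    have := hmono (left_mem_Icc.2 hst.le) (Ioc_subset_Icc_self hx) hx.1
    have h1 : 0 ≤ d s * Real.exp (-I s) := mul_nonneg h0 (Real.exp_pos _).le
    exact pos_of_mul_pos_left (h1.trans_lt this) (Real.exp_pos _).le
  · intro h0 x hx
    have := hmono (Ico_subset_Icc_self hx) (right_mem_Icc.2 hst.le) hx.2
    have h1 : d t * Real.exp (-I t) ≤ 0 := mul_nonpos_of_nonpos_of_nonneg h0 (Real.exp_pos _).le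
    exact neg_of_mul_neg_left (this.trans_le h1) (Real.exp_pos _).le

/-- The positive root `κ` of `κ² + (c + R(1-q)² - Rβ) κ = R²β(1-q)²`, where `β = b₂ - 1` and
`c = b₁ (n - m) / (1 - R)`. -/
noncomputable def kap (R β q c : ℝ) : ℝ :=
  Real.sqrt (((c + R * (1 - q) ^ 2 - R * β) / 2) ^ 2 + R ^ 2 * β * (1 - q) ^ 2)
    - (c + R * (1 - q) ^ 2 - R * β) / 2

/-- The denominator of the logarithmic slope. -/
noncomputable def slopeDen (R β q c : ℝ) : ℝ :=
  ((1 - R) * q + R) * kap R β q c - R ^ 2 * β * (1 - q)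

/-- The logarithmic slope: `O(q, n) = (1 - R) n · slope`. -/
noncomputable def logSlope (R β q c : ℝ) : ℝ := (kap R β q c - R * β) / slopeDen R β q c

/-- Minus the difference quotient of the logarithmic slope in its last argument. -/
noncomputable def slopeQuot (R β q c₁ c₂ : ℝ) : ℝ :=
  R * β * q * (kap R β q c₁ * kap R β q c₂) /
    ((kap R β q c₁ * kap R β q c₂ + R ^ 2 * β * (1 - q) ^ 2) *
      (slopeDen R β q c₁ * slopeDen R β q c₂))

section Slope

variable {R β : ℝ}

theorem kap_quadratic (hβ : 0 < β) (q c : ℝ) :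
    kap R β q c ^ 2 + (c + R * (1 - q) ^ 2 - R * β) * kap R β q c = R ^ 2 * β * (1 - q) ^ 2 := by
  have h : 0 ≤ ((c + R * (1 - q) ^ 2 - R * β) / 2) ^ 2 + R ^ 2 * β * (1 - q) ^ 2 := by positivity
  have := Real.sq_sqrt h
  unfold kap
  linear_combination this

theorem kap_pos (hR : 0 < R) (hβ : 0 < β) {q : ℝ} (hq : q ≠ 1) (c : ℝ) : 0 < kap R β q c := by
  have hq' : 1 - q ≠ 0 := sub_ne_zero.2 hq.symm
  unfold kap
  rw [sub_pos]
  refine (le_abs_self _).trans_lt ?_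
  rw [← Real.sqrt_sq_eq_abs]
  refine Real.sqrt_lt_sqrt (sq_nonneg _) ?_
  have : 0 < R ^ 2 * β * (1 - q) ^ 2 := by positivity
  linarith

theorem kap_zero (hR : 0 < R) (hβ : 0 < β) (q : ℝ) : kap R β q 0 = R * β := by
  unfold kap
  have : ((0 + R * (1 - q) ^ 2 - R * β) / 2) ^ 2 + R ^ 2 * β * (1 - q) ^ 2
      = ((R * (1 - q) ^ 2 + R * β) / 2) ^ 2 := by ring
  rw [this, Real.sqrt_sq (by positivity)]
  ring

theorem slopeDen_zero (hR : 0 < R) (hβ : 0 < β) (q : ℝ) : slopeDen R β q 0 = R * β * q := by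
  rw [slopeDen, kap_zero hR hβ]; ring

theorem slope_zero (hR : 0 < R) (hβ : 0 < β) (q : ℝ) : logSlope R β q 0 = 0 := by
  rw [logSlope, kap_zero hR hβ]; simp

theorem slopeQuot_pos (hR : 0 < R) (hβ : 0 < β) {q c₁ c₂ : ℝ} (hq : 0 < q)
    (hk₁ : 0 < kap R β q c₁) (hk₂ : 0 < kap R β q c₂)
    (hT₁ : 0 < slopeDen R β q c₁) (hT₂ : 0 < slopeDen R β q c₂) : 0 < slopeQuot R β q c₁ c₂ := by
  unfold slopeQuot; positivity

theorem slope_sub (hβ : 0 < β) {q c₁ c₂ : ℝ}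
    (hk₁ : 0 < kap R β q c₁) (hk₂ : 0 < kap R β q c₂)
    (hT₁ : 0 < slopeDen R β q c₁) (hT₂ : 0 < slopeDen R β q c₂) :
    logSlope R β q c₁ - logSlope R β q c₂ = -(slopeQuot R β q c₁ c₂ * (c₁ - c₂)) := by
  have e₁ := kap_quadratic (R := R) hβ q c₁
  have e₂ := kap_quadratic (R := R) hβ q c₂
  have hpos : 0 < kap R β q c₁ * kap R β q c₂ + R ^ 2 * β * (1 - q) ^ 2 := by positivity
  have hdiff : (kap R β q c₁ - kap R β q c₂) *
      (kap R β q c₁ * kap R β q c₂ + R ^ 2 * β * (1 - q) ^ 2)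
        = -((c₁ - c₂) * (kap R β q c₁ * kap R β q c₂)) := by
    linear_combination kap R β q c₂ * e₁ - kap R β q c₁ * e₂
  have hW : logSlope R β q c₁ - logSlope R β q c₂ = R * β * q * (kap R β q c₁ - kap R β q c₂) /
      (slopeDen R β q c₁ * slopeDen R β q c₂) := by
    unfold logSlope
    rw [div_sub_div _ _ hT₁.ne' hT₂.ne']
    congr 1
    unfold slopeDen
    ring
  rw [hW, slopeQuot, div_mul_eq_mul_div, ← neg_div, div_eq_div_iff (by positivity) (by positivity)]
  linear_combination R * β * q * (slopeDen R β q c₁ * slopeDen R β q c₂) * hdiff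

theorem continuousOn_kap {c : ℝ → ℝ} {S : Set ℝ} (hc : ContinuousOn c S) :
    ContinuousOn (fun q => kap R β q (c q)) S := by
  unfold kap; fun_prop

theorem continuousOn_slopeDen {c : ℝ → ℝ} {S : Set ℝ} (hc : ContinuousOn c S) :
    ContinuousOn (fun q => slopeDen R β q (c q)) S := by
  have := continuousOn_kap (R := R) (β := β) hc
  unfold slopeDen; fun_prop

end Slope

/-- The free boundary value problem in terms of `c = b₁ (n - m) / (1 - R)`, with `β = b₂ - 1`. -/
structure ReducedSolution (R β b₁ b₃ C : ℝ) (c : ℝ → ℝ) (s t : ℝ) : Prop where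
  left_pos : 0 < s
  lt : s < t
  kap_pos : ∀ q ∈ Icc s t, 0 < kap R β q (c q)
  den_pos : ∀ q ∈ Icc s t, 0 < slopeDen R β q (c q)
  ode : ∀ q ∈ Icc s t, HasDerivWithinAt c
    ((b₁ + (1 - R) * (c q - b₃ * q + R * q ^ 2)) * logSlope R β q (c q) + (b₃ - 2 * R * q))
    (Icc s t) q
  left : c s = 0
  right : c t = 0
  cost : C = ∫ q in s..t, -(R / q * logSlope R β q (c q))

namespace ReducedSolution

variable {R β b₁ b₃ C s t : ℝ} {c : ℝ → ℝ}

theorem pos_of_mem (h : ReducedSolution R β b₁ b₃ C c s t) {q : ℝ} (hq : q ∈ Icc s t) : 0 < q :=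
  h.left_pos.trans_le hq.1

theorem continuousOn (h : ReducedSolution R β b₁ b₃ C c s t) : ContinuousOn c (Icc s t) :=
  fun q hq => (h.ode q hq).continuousWithinAt

theorem continuousOn_slope (h : ReducedSolution R β b₁ b₃ C c s t) :
    ContinuousOn (fun q => logSlope R β q (c q)) (Icc s t) := by
  unfold logSlope
  exact ((continuousOn_kap h.continuousOn).sub continuousOn_const).div
    (continuousOn_slopeDen h.continuousOn) fun q hq => (h.den_pos q hq).ne'

theorem continuousOn_integrand (h : ReducedSolution R β b₁ b₃ C c s t) :
    ContinuousOn (fun q => -(R / q * logSlope R β q (c q))) (Icc s t) :=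
  ((continuousOn_const.div continuousOn_id fun _ hq => (h.pos_of_mem hq).ne').mul
    h.continuousOn_slope).neg

theorem slope_eq (h : ReducedSolution R β b₁ b₃ C c s t) (hR : 0 < R) (hβ : 0 < β) {q : ℝ}
    (hq : q ∈ Icc s t) : logSlope R β q (c q) = -(slopeQuot R β q (c q) 0 * c q) := by
  have hq0 := h.pos_of_mem hq
  have := slope_sub hβ (h.kap_pos q hq) (c₂ := 0) (by rw [kap_zero hR hβ]; positivity)
    (h.den_pos q hq) (by rw [slopeDen_zero hR hβ]; positivity)
  simpa [slope_zero hR hβ] using this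

theorem quot_zero_pos (h : ReducedSolution R β b₁ b₃ C c s t) (hR : 0 < R) (hβ : 0 < β) {q : ℝ}
    (hq : q ∈ Icc s t) : 0 < slopeQuot R β q (c q) 0 := by
  have hq0 := h.pos_of_mem hq
  exact slopeQuot_pos hR hβ hq0 (h.kap_pos q hq) (by rw [kap_zero hR hβ]; positivity)
    (h.den_pos q hq) (by rw [slopeDen_zero hR hβ]; positivity)

theorem continuousOn_quot {c' : ℝ → ℝ} {S : Set ℝ} (hR : R ≠ 0) (hβ : 0 < β)
    (hc : ContinuousOn c S) (hc' : ContinuousOn c' S)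
    (hk : ∀ q ∈ S, 0 < kap R β q (c q)) (hk' : ∀ q ∈ S, 0 < kap R β q (c' q))
    (hT : ∀ q ∈ S, 0 < slopeDen R β q (c q)) (hT' : ∀ q ∈ S, 0 < slopeDen R β q (c' q)) :
    ContinuousOn (fun q => slopeQuot R β q (c q) (c' q)) S := by
  have k := continuousOn_kap (R := R) (β := β) hc
  have k' := continuousOn_kap (R := R) (β := β) hc'
  have T := continuousOn_slopeDen (R := R) (β := β) hc
  have T' := continuousOn_slopeDen (R := R) (β := β) hc'
  unfold slopeQuot
  refine ContinuousOn.div (by fun_prop) (by fun_prop) fun q hq => ?_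
  have := hk q hq
  have := hk' q hq
  have := hT q hq
  have := hT' q hq
  positivity

/-- The vertex `b₃ / (2R)` of `m` is inside the interval, in whose interior `c` is positive. -/
theorem vertex_and_pos (h : ReducedSolution R β b₁ b₃ C c s t) (hR : 0 < R) (hβ : 0 < β) :
    s < b₃ / (2 * R) ∧ b₃ / (2 * R) < t ∧ ∀ q ∈ Ioo s t, 0 < c q := by
  set v := b₃ / (2 * R) with hv
  have hvR : b₃ = 2 * R * v := by rw [hv]; field_simp
  set ρ : ℝ → ℝ := fun q =>
    -((b₁ + (1 - R) * (c q - b₃ * q + R * q ^ 2)) * slopeQuot R β q (c q) 0) with hρ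
  have hρc : ContinuousOn ρ (Icc s t) := by
    have hc := h.continuousOn
    have hQ : ContinuousOn (fun q => slopeQuot R β q (c q) 0) (Icc s t) :=
      continuousOn_quot (c' := fun _ => 0) hR.ne' hβ hc
        continuousOn_const h.kap_pos (fun q _ => by rw [kap_zero hR hβ]; positivity) h.den_pos
        (fun q hq => by
          have := h.pos_of_mem hq
          rw [slopeDen_zero hR hβ]; positivity)
    fun_prop
  have hd : ∀ q ∈ Icc s t, HasDerivWithinAt c (ρ q * c q + (b₃ - 2 * R * q)) (Icc s t) q := by
    intro q hq
    refine (h.ode q hq).congr_deriv ?_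
    rw [h.slope_eq hR hβ hq, hρ]
    ring
  have up : ∀ u, u ≤ v → u ≤ t → ∀ q ∈ Ioc s u, 0 < c q := by
    intro u huv hut
    have hsub : Icc s u ⊆ Icc s t := Icc_subset_Icc_right hut
    refine (linear_ode_sign (fun q hq => (hd q (hsub hq)).mono hsub) (hρc.mono hsub) ?_).1
      h.left.ge
    intro q hq
    have : 0 < R * (v - q) := mul_pos hR (by linarith [hq.2])
    linarith
  have down : ∀ u, v ≤ u → s ≤ u → ∀ q ∈ Ico u t, 0 < c q := by
    intro u huv hut
    have hsub : Icc u t ⊆ Icc s t := Icc_subset_Icc_left hut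
    have := (linear_ode_sign (d := fun q => -c q) (σ := fun q => -(b₃ - 2 * R * q)) (ρ := ρ)
      (fun q hq => ?_) (hρc.mono hsub) ?_).2 (by simp [h.right])
    · intro q hq
      simpa using this q hq
    · refine ((hd q (hsub hq)).mono hsub).fun_neg.congr_deriv ?_
      ring
    · intro q hq
      have : 0 < R * (q - v) := mul_pos hR (by linarith [hq.1])
      linarith
  have h1 : s < v := by
    by_contra! hvs
    exact (down s hvs le_rfl s ⟨le_rfl, h.lt⟩).ne' h.left
  have h2 : v < t := by
    by_contra! hvs
    exact (up t hvs le_rfl t ⟨h.lt, le_rfl⟩).ne' h.right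
  refine ⟨h1, h2, fun q hq => ?_⟩
  rcases le_total q v with hqv | hqv
  · exact up v le_rfl h2.le q ⟨hq.1, hqv⟩
  · exact down v le_rfl h1.le q ⟨hqv, hq.2⟩

theorem nonneg (h : ReducedSolution R β b₁ b₃ C c s t) (hR : 0 < R) (hβ : 0 < β) {q : ℝ}
    (hq : q ∈ Icc s t) : 0 ≤ c q := by
  rcases eq_or_lt_of_le hq.1 with rfl | h1
  · exact h.left.ge
  rcases eq_or_lt_of_le hq.2 with rfl | h2
  · exact h.right.ge
  exact ((h.vertex_and_pos hR hβ).2.2 q ⟨h1, h2⟩).le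

theorem slope_neg (h : ReducedSolution R β b₁ b₃ C c s t) (hR : 0 < R) (hβ : 0 < β) {q : ℝ}
    (hq : q ∈ Ioo s t) : logSlope R β q (c q) < 0 := by
  have hq' := Ioo_subset_Icc_self hq
  rw [h.slope_eq hR hβ hq']
  exact neg_neg_of_pos (mul_pos (h.quot_zero_pos hR hβ hq') ((h.vertex_and_pos hR hβ).2.2 q hq))

theorem integrand_nonneg (h : ReducedSolution R β b₁ b₃ C c s t) (hR : 0 < R) (hβ : 0 < β) {q : ℝ}
    (hq : q ∈ Icc s t) : 0 ≤ -(R / q * logSlope R β q (c q)) := by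
  have := h.pos_of_mem hq
  have h1 := h.quot_zero_pos hR hβ hq
  have h2 := h.nonneg hR hβ hq
  rw [h.slope_eq hR hβ hq, mul_neg, neg_neg]
  positivity

variable {b₁' b₃' C' s' t' : ℝ} {c' : ℝ → ℝ}

/-- A solution on a smaller interval that is smaller in the interior has smaller costs. -/
theorem cost_lt (h : ReducedSolution R β b₁ b₃ C c s t)
    (h' : ReducedSolution R β b₁' b₃' C' c' s' t') (hR : 0 < R) (hβ : 0 < β)
    (hs : s' ≤ s) (ht : t ≤ t') (hlt : ∀ q ∈ Ioo s t, c q < c' q) : C < C' := by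
  have hsub : Icc s t ⊆ Icc s' t' := Icc_subset_Icc hs ht
  have hlt' : ∀ q ∈ Ioo s t, -(R / q * logSlope R β q (c q)) < -(R / q * logSlope R β q (c' q)) := by
    intro q hq
    have hq1 := Ioo_subset_Icc_self hq
    have hq0 := h.pos_of_mem hq1
    have e := slope_sub hβ (h.kap_pos q hq1) (h'.kap_pos q (hsub hq1)) (h.den_pos q hq1)
      (h'.den_pos q (hsub hq1))
    have k := slopeQuot_pos hR hβ hq0 (h.kap_pos q hq1) (h'.kap_pos q (hsub hq1)) (h.den_pos q hq1)
      (h'.den_pos q (hsub hq1))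
    have : 0 < slopeQuot R β q (c q) (c' q) * (c' q - c q) :=
      mul_pos k (sub_pos.2 (hlt q hq))
    have h3 : logSlope R β q (c' q) < logSlope R β q (c q) := by linarith
    have := mul_lt_mul_of_pos_left h3 (div_pos hR hq0)
    linarith
  have hle : ∀ q ∈ Icc s t, -(R / q * logSlope R β q (c q)) ≤ -(R / q * logSlope R β q (c' q)) := by
    rw [← closure_Ioo h.lt.ne]
    have hcl : closure (Ioo s t) = Icc s t := closure_Ioo h.lt.ne
    intro q hq
    refine ContinuousWithinAt.closure_le hq ?_ ?_ fun y hy => (hlt' y hy).le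
    · exact (h.continuousOn_integrand q (hcl ▸ hq)).mono Ioo_subset_Icc_self
    · exact (h'.continuousOn_integrand q (hsub (hcl ▸ hq))).mono
        (Ioo_subset_Icc_self.trans hsub)
  obtain ⟨x, hx⟩ := exists_between h.lt
  rw [h.cost, h'.cost]
  calc _ < ∫ q in s..t, -(R / q * logSlope R β q (c' q)) :=
        intervalIntegral.integral_lt_integral_of_continuousOn_of_le_of_exists_lt h.lt
          h.continuousOn_integrand (h'.continuousOn_integrand.mono hsub)
          (fun q hq => hle q (Ioc_subset_Icc_self hq)) ⟨x, Ioo_subset_Icc_self hx, hlt' x hx⟩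
    _ ≤ _ := by
      refine intervalIntegral.integral_mono_interval hs h.lt.le ht ?_ ?_
      · refine (MeasureTheory.ae_restrict_iff' measurableSet_Ioc).2 (Filter.Eventually.of_forall ?_)
        intro q hq
        exact h'.integrand_nonneg hR hβ (Ioc_subset_Icc_self hq)
      · exact h'.continuousOn_integrand.intervalIntegrable_of_Icc h'.lt.le

/-- The difference of two solutions satisfies a linear equation with positive source term. -/
theorem sub_sign (h : ReducedSolution R β b₁ b₃ C c s t)
    (h' : ReducedSolution R β b₁' b₃' C' c' s' t') (hR : 0 < R) (hβ : 0 < β)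
    (hσ : ∀ q w : ℝ, 0 < q → w < 0 → 0 < (b₁' - b₁) * w + (b₃' - b₃) * (1 - (1 - R) * q * w))
    {u v : ℝ} (hu : s ≤ u) (hu' : s' ≤ u) (hv : v ≤ t) (hv' : v ≤ t') :
    (c u ≤ c' u → ∀ x ∈ Ioc u v, c x < c' x) ∧ (c' v ≤ c v → ∀ x ∈ Ico u v, c' x < c x) := by
  have hsub : Icc u v ⊆ Icc s t := Icc_subset_Icc hu hv
  have hsub' : Icc u v ⊆ Icc s' t' := Icc_subset_Icc hu' hv'
  have key := linear_ode_sign (s := u) (t := v) (d := fun q => c' q - c q)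
    (ρ := fun q => (1 - R) * logSlope R β q (c' q)
      - (b₁' + (1 - R) * (c q - b₃' * q + R * q ^ 2)) * slopeQuot R β q (c' q) (c q))
    (σ := fun q => (b₁' - b₁) * logSlope R β q (c q)
      + (b₃' - b₃) * (1 - (1 - R) * q * logSlope R β q (c q))) ?_ ?_ ?_
  · simpa only [sub_nonneg, sub_nonpos, sub_pos, sub_neg] using key
  · intro q hq
    refine (((h'.ode q (hsub' hq)).mono hsub').fun_sub
      ((h.ode q (hsub hq)).mono hsub)).congr_deriv ?_
    have e := slope_sub hβ (h'.kap_pos q (hsub' hq)) (h.kap_pos q (hsub hq))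
      (h'.den_pos q (hsub' hq)) (h.den_pos q (hsub hq))
    linear_combination (b₁' + (1 - R) * (c q - b₃' * q + R * q ^ 2)) * e
  · have hc := h.continuousOn.mono hsub
    have hc' := h'.continuousOn.mono hsub'
    have hw := h'.continuousOn_slope.mono hsub'
    have hQ : ContinuousOn (fun q => slopeQuot R β q (c' q) (c q)) (Icc u v) :=
      continuousOn_quot hR.ne' hβ hc' hc
        (fun q hq => h'.kap_pos q (hsub' hq)) (fun q hq => h.kap_pos q (hsub hq))
        (fun q hq => h'.den_pos q (hsub' hq)) (fun q hq => h.den_pos q (hsub hq))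
    fun_prop
  · intro q hq
    exact hσ q _ (h.pos_of_mem (hsub (Ioo_subset_Icc_self hq)))
      (h.slope_neg hR hβ ⟨hu.trans_lt hq.1, hq.2.trans_le hv⟩)

/-- Comparison of the free boundaries for the same costs. -/
theorem boundaries_lt (h : ReducedSolution R β b₁ b₃ C c s t)
    (h' : ReducedSolution R β b₁' b₃' C c' s' t') (hR : 0 < R) (hβ : 0 < β) (hb₃ : b₃ ≤ b₃')
    (hσ : ∀ q w : ℝ, 0 < q → w < 0 → 0 < (b₁' - b₁) * w + (b₃' - b₃) * (1 - (1 - R) * q * w)) :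
    s < s' ∧ t < t' := by
  have hs : s < s' := by
    by_contra! hs
    have hst' : s < t' := (h.vertex_and_pos hR hβ).1.trans_le
      ((div_le_div_of_nonneg_right hb₃ (by positivity)).trans (h'.vertex_and_pos hR hβ).2.1.le)
    have hcs : c s ≤ c' s := h.left.trans_le (h'.nonneg hR hβ ⟨hs, hst'.le⟩)
    have ht : t ≤ t' := by
      by_contra! ht
      have := (h.sub_sign h' hR hβ hσ le_rfl hs ht.le le_rfl).1 hcs t' ⟨hst', le_rfl⟩
      rw [h'.right] at this
      exact (h.nonneg hR hβ ⟨hst'.le, ht.le⟩).not_gt this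
    exact (h.cost_lt h' hR hβ hs ht fun q hq =>
      (h.sub_sign h' hR hβ hσ le_rfl hs le_rfl ht).1 hcs q (Ioo_subset_Ioc_self hq)).false
  refine ⟨hs, ?_⟩
  by_contra! ht
  have hct : c' t' ≤ c t' := h'.right.trans_le (h.nonneg hR hβ ⟨(hs.trans h'.lt).le, ht⟩)
  exact (h'.cost_lt h hR hβ hs.le ht fun q hq =>
    (h.sub_sign h' hR hβ hσ hs.le le_rfl ht le_rfl).2 hct q (Ioo_subset_Ico_self hq)).false

theorem integrand_le (h : ReducedSolution R β b₁ b₃ C c s t) {q : ℝ}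
    (hq : q ∈ Icc s t) (hq1 : 1 < q) :
    -(R / q * logSlope R β q (c q)) ≤ 1 / (q - 1) - 1 / q := by
  have hq0 := h.pos_of_mem hq
  have hk := h.kap_pos q hq
  have hT := h.den_pos q hq
  have hq1' : 0 < q - 1 := sub_pos.2 hq1
  have e : 1 / (q - 1) - 1 / q - -(R / q * logSlope R β q (c q))
      = kap R β q (c q) / ((q - 1) * slopeDen R β q (c q)) := by
    unfold logSlope
    field_simp
    unfold slopeDen
    ring
  have : 0 ≤ kap R β q (c q) / ((q - 1) * slopeDen R β q (c q)) := by positivity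
  linarith

theorem exp_cost_mul_lt (h : ReducedSolution R β b₁ b₃ C c s t) :
    Real.exp C * (s - 1) < s := by
  have hs0 := h.left_pos
  rcases le_or_gt s 1 with hs | hs
  · exact (mul_nonpos_of_nonneg_of_nonpos (Real.exp_pos C).le (by linarith)).trans_lt hs0
  have hst := h.lt
  have hcont : ContinuousOn (fun q : ℝ => 1 / (q - 1) - 1 / q) (Icc s t) := by
    refine (continuousOn_const.div (by fun_prop) fun q hq => ?_).sub
      (continuousOn_const.div (by fun_prop) fun q hq => ?_)
    · have := hq.1; linarith
    · have := hq.1; linarith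
  have h1 : C ≤ ∫ q in s..t, (1 / (q - 1) - 1 / q) := by
    rw [h.cost]
    exact intervalIntegral.integral_mono_on hst.le
      (h.continuousOn_integrand.intervalIntegrable_of_Icc hst.le)
      (hcont.intervalIntegrable_of_Icc hst.le)
      fun q hq => h.integrand_le hq (hs.trans_le hq.1)
  have h2 : ∫ q in s..t, (1 / (q - 1) - 1 / q)
      = (Real.log (t - 1) - Real.log t) - (Real.log (s - 1) - Real.log s) := by
    refine intervalIntegral.integral_eq_sub_of_hasDerivAt
      (f := fun q => Real.log (q - 1) - Real.log q) (fun q hq => ?_)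
      (hcont.intervalIntegrable_of_Icc hst.le)
    rw [uIcc_of_le hst.le] at hq
    have hq1 : q - 1 ≠ 0 := by have := hq.1; linarith
    have hq0 : q ≠ 0 := (h.pos_of_mem hq).ne'
    exact (((hasDerivAt_id q).sub_const 1).log hq1).sub ((hasDerivAt_id q).log hq0)
  have h3 : Real.log (t - 1) < Real.log t := Real.log_lt_log (by linarith) (by linarith)
  have h4 : C + Real.log (s - 1) < Real.log s := by linarith
  have h5 := Real.exp_lt_exp.2 h4
  rwa [Real.exp_add, Real.exp_log (by linarith), Real.exp_log hs0] at h5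

end ReducedSolution

namespace AuxParams

/-- The excess of `n` over `m` in the scale in which `m` and the slope lose their dependence on
`b₁`. -/
noncomputable def excess (P : AuxParams) (q n : ℝ) : ℝ := P.b₁ * (n - P.m q) / (1 - P.R)

variable {P : AuxParams}

theorem Valid.one_sub_R_ne (hP : P.Valid) : 1 - P.R ≠ 0 := sub_ne_zero.2 hP.R_ne_one.symm

theorem Valid.β_pos (hP : P.Valid) : 0 < P.b₂ - 1 := sub_pos.2 hP.one_lt_b₂

theorem phi_eq (hP : P.Valid) (q n : ℝ) :
    P.phi q n = 2 * (1 - P.R) *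
      ((P.excess q n + P.R * (1 - q) ^ 2 - P.R * (P.b₂ - 1)) / 2) := by
  have h1 := hP.one_sub_R_ne
  have h2 := hP.b₁_pos.ne'
  unfold phi excess m
  field_simp
  ring

theorem sign_mul_abs (x : ℝ) : Real.sign x * |x| = x := by
  rcases lt_trichotomy x 0 with h | rfl | h
  · rw [Real.sign_of_neg h, abs_of_neg h]; ring
  · simp
  · rw [Real.sign_of_pos h, abs_of_pos h]; ring

theorem kap_mul_den (hP : P.Valid) (q n : ℝ) :
    kap P.R (P.b₂ - 1) q (P.excess q n) * P.den q n =
      2 * (1 - P.R) * (1 - q) * slopeDen P.R (P.b₂ - 1) q (P.excess q n) := by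
  have hquad := kap_quadratic (R := P.R) hP.β_pos q (P.excess q n)
  have hden : P.den q n = 2 * (1 - P.R) * ((1 - q) * ((1 - P.R) * q + P.R)
      - (kap P.R (P.b₂ - 1) q (P.excess q n) +
        (P.excess q n + P.R * (1 - q) ^ 2 - P.R * (P.b₂ - 1)))) := by
    have hsq : P.phi q n ^ 2 + P.Esq q = (2 * |1 - P.R|) ^ 2 *
        (((P.excess q n + P.R * (1 - q) ^ 2 - P.R * (P.b₂ - 1)) / 2) ^ 2
          + P.R ^ 2 * (P.b₂ - 1) * (1 - q) ^ 2) := by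
      rw [phi_eq hP, Esq, mul_pow 2 |1 - P.R|, sq_abs]
      ring
    have hs := sign_mul_abs (1 - P.R)
    rw [den, hsq, Real.sqrt_mul (sq_nonneg _), Real.sqrt_sq (by positivity), phi_eq hP, kap]
    linear_combination (-2 * Real.sqrt (((P.excess q n + P.R * (1 - q) ^ 2
      - P.R * (P.b₂ - 1)) / 2) ^ 2 + P.R ^ 2 * (P.b₂ - 1) * (1 - q) ^ 2)) * hs
  rw [hden, slopeDen]
  linear_combination -2 * (1 - P.R) * hquad

theorem kap_one (hP : P.Valid) {n : ℝ} (h : (1 - P.R) * n < (1 - P.R) * P.ell 1) :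
    kap P.R (P.b₂ - 1) 1 (P.excess 1 n) = P.b₁ * (P.ell 1 - n) / (1 - P.R) ∧
      0 < kap P.R (P.b₂ - 1) 1 (P.excess 1 n) := by
  have h1 := hP.one_sub_R_ne
  have h2 := hP.b₁_pos
  have e : (P.excess 1 n + P.R * (1 - 1) ^ 2 - P.R * (P.b₂ - 1)) / 2
      = -(P.b₁ * (P.ell 1 - n) / (1 - P.R)) / 2 := by
    unfold excess ell
    field_simp
    ring
  have hpos : 0 < P.b₁ * (P.ell 1 - n) / (1 - P.R) := by
    have : P.b₁ * (P.ell 1 - n) / (1 - P.R)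
        = P.b₁ * ((1 - P.R) * P.ell 1 - (1 - P.R) * n) / (1 - P.R) ^ 2 := by
      field_simp
    rw [this]
    have := sub_pos.2 h
    positivity
  have e2 : kap P.R (P.b₂ - 1) 1 (P.excess 1 n) = P.b₁ * (P.ell 1 - n) / (1 - P.R) := by
    rw [kap, e, sub_self, zero_pow two_ne_zero, mul_zero, add_zero, Real.sqrt_sq_eq_abs,
      abs_of_neg (by linarith)]
    ring
  exact ⟨e2, e2 ▸ hpos⟩

theorem ODomain.kap_pos (hP : P.Valid) {q n : ℝ} (h : P.ODomain q n) :
    0 < kap P.R (P.b₂ - 1) q (P.excess q n) := by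
  rcases h with ⟨hq, -⟩ | ⟨rfl, h⟩
  · exact _root_.kap_pos hP.R_pos hP.β_pos hq _
  · exact (kap_one hP h).2

theorem ODomain.slopeDen_ne_zero (hP : P.Valid) {q n : ℝ} (h : P.ODomain q n) :
    slopeDen P.R (P.b₂ - 1) q (P.excess q n) ≠ 0 := by
  have hk := ODomain.kap_pos hP h
  rcases h with ⟨-, hd⟩ | ⟨rfl, -⟩
  · intro h0
    have := kap_mul_den hP q n
    rw [h0, mul_zero] at this
    exact mul_ne_zero hk.ne' hd this
  · simpa [slopeDen] using hk.ne'

theorem ODomain.O_eq (hP : P.Valid) {q n : ℝ} (h : P.ODomain q n) :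
    P.O q n = (1 - P.R) * n * logSlope P.R (P.b₂ - 1) q (P.excess q n) := by
  have hk := ODomain.kap_pos hP h
  have hT := ODomain.slopeDen_ne_zero hP h
  have h1 := hP.one_sub_R_ne
  have h2 := hP.b₁_pos.ne'
  have hR := hP.R_pos.ne'
  rcases h with ⟨hq, hd⟩ | ⟨rfl, h⟩
  · have hq' : 1 - q ≠ 0 := sub_ne_zero.2 hq.symm
    have hden : P.den q n = 2 * (1 - P.R) * (1 - q) *
        slopeDen P.R (P.b₂ - 1) q (P.excess q n) / kap P.R (P.b₂ - 1) q (P.excess q n) := by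
      rw [eq_div_iff hk.ne', ← kap_mul_den hP]; ring
    rw [O, if_neg hq, hden, logSlope]
    generalize hK : kap P.R (P.b₂ - 1) q (P.excess q n) = K at *
    have e : slopeDen P.R (P.b₂ - 1) q (P.excess q n)
        = ((1 - P.R) * q + P.R) * K - P.R ^ 2 * (P.b₂ - 1) * (1 - q) := by rw [slopeDen, hK]
    generalize slopeDen P.R (P.b₂ - 1) q (P.excess q n) = T at *
    have hk' := hk.ne'
    field_simp
    rw [e]
    ring
  · obtain ⟨hk1, -⟩ := kap_one hP h
    have hne : P.ell 1 - n ≠ 0 := by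
      intro h0
      rw [h0] at hk1
      simp [hk1] at hk
    rw [O, if_pos rfl, logSlope, slopeDen, hk1]
    have he : P.ell 1 = P.m 1 + (P.b₂ - 1) * P.R * (1 - P.R) / P.b₁ := by
      unfold ell; ring
    have e3 : P.b₁ * (P.ell 1 - n) / (1 - P.R) - P.R * (P.b₂ - 1)
        = P.b₁ * (P.m 1 - n) / (1 - P.R) := by
      rw [he]; field_simp; ring
    rw [e3]
    field_simp
    ring

end AuxParams

theorem IsFreeBoundarySolution.reduced {P : AuxParams} (hP : P.Valid) {ξ qL qU : ℝ} {n : ℝ → ℝ}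
    (h : IsFreeBoundarySolution P ξ n qL qU) :
    ReducedSolution P.R (P.b₂ - 1) P.b₁ P.b₃ (Real.log (1 + ξ))
      (fun q => P.excess q (n q)) qL qU := by
  have h1 := hP.one_sub_R_ne
  have h2 := hP.b₁_pos.ne'
  have hm : ∀ q, HasDerivAt P.m ((1 - P.R) / P.b₁ * (2 * P.R * q - P.b₃)) q := by
    intro q
    have := ((((hasDerivAt_id q).pow 2).const_mul (P.R * (1 - P.R) / P.b₁)).sub
      ((hasDerivAt_id q).const_mul (P.b₃ * (1 - P.R) / P.b₁))).add_const 1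
    refine this.congr_deriv ?_
    simp
    ring
  have hode : ∀ q ∈ Icc qL qU, HasDerivWithinAt (fun q => P.excess q (n q))
      ((P.b₁ + (1 - P.R) * (P.excess q (n q) - P.b₃ * q + P.R * q ^ 2)) *
        logSlope P.R (P.b₂ - 1) q (P.excess q (n q)) + (P.b₃ - 2 * P.R * q)) (Icc qL qU) q := by
    intro q hq
    have := ((((h.ode q hq).fun_sub (hm q).hasDerivWithinAt).const_mul P.b₁).div_const (1 - P.R))
    refine this.congr_deriv ?_
    rw [AuxParams.ODomain.O_eq hP (h.mem_domain q hq)]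
    have : P.b₁ + (1 - P.R) * (P.excess q (n q) - P.b₃ * q + P.R * q ^ 2) = P.b₁ * n q := by
      unfold AuxParams.excess AuxParams.m
      field_simp
      ring
    rw [this]
    field_simp
    ring
  have hleft : P.excess qL (n qL) = 0 := by simp [AuxParams.excess, h.left_boundary]
  have hcont : ContinuousOn (fun q => P.excess q (n q)) (Icc qL qU) :=
    fun q hq => (hode q hq).continuousWithinAt
  refine ⟨h.qL_pos, h.qL_lt_qU, fun q hq => AuxParams.ODomain.kap_pos hP (h.mem_domain q hq), ?_,
    hode, hleft, by simp [AuxParams.excess, h.right_boundary], ?_⟩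
  · intro q hq
    by_contra! hneg
    have hsub : Icc qL q ⊆ Icc qL qU := Icc_subset_Icc_right hq.2
    have hpos : 0 ≤ slopeDen P.R (P.b₂ - 1) qL (P.excess qL (n qL)) := by
      rw [hleft, slopeDen_zero hP.R_pos hP.β_pos]
      exact (mul_pos (mul_pos hP.R_pos hP.β_pos) h.qL_pos).le
    obtain ⟨x, hx, hx0⟩ := intermediate_value_Icc' hq.1
      (continuousOn_slopeDen (R := P.R) (β := P.b₂ - 1) (hcont.mono hsub)) ⟨hneg, hpos⟩
    exact AuxParams.ODomain.slopeDen_ne_zero hP (h.mem_domain x (hsub hx)) hx0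
  · rw [h.cost]
    refine intervalIntegral.integral_congr fun q hq => ?_
    rw [uIcc_of_le h.qL_lt_qU.le] at hq
    have hn := (h.pos q hq).ne'
    have hq0 : q ≠ 0 := (h.qL_pos.trans_le hq.1).ne'
    rw [AuxParams.ODomain.O_eq hP (h.mem_domain q hq)]
    field_simp

section Boundaries

variable {lam gam : ℝ}

theorem one_add_roundTrip (hgam1 : gam < 1) : 1 + roundTrip lam gam = (1 + lam) / (1 - gam) := by
  have : 1 - gam ≠ 0 := by linarith
  unfold roundTrip
  field_simp
  ring

theorem IsFreeBoundarySolution.purchase_den_pos {P : AuxParams} (hP : P.Valid) {qL qU : ℝ}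
    {n : ℝ → ℝ} (hlam : 0 ≤ lam) (hgam : 0 ≤ gam) (hgam1 : gam < 1)
    (h : IsFreeBoundarySolution P (roundTrip lam gam) n qL qU) : 0 < 1 + lam * (1 - qL) := by
  have key := (h.reduced hP).exp_cost_mul_lt
  have hg : 0 < 1 - gam := sub_pos.2 hgam1
  have hpos : 0 < (1 + lam) / (1 - gam) := by positivity
  rw [one_add_roundTrip hgam1, Real.exp_log hpos] at key
  rcases le_or_gt qL 1 with hq | hq
  · have := mul_nonneg hlam (sub_nonneg.2 hq)
    linarith
  · have h1 : 1 + lam ≤ (1 + lam) / (1 - gam) := by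
      rw [le_div_iff₀ hg]
      have := mul_nonneg hgam (by linarith : 0 ≤ 1 + lam)
      linarith
    have := mul_le_mul_of_nonneg_right h1 (sub_nonneg.2 hq.le)
    linarith

theorem purchaseBoundary_lt {q q' : ℝ} (hlam : 0 ≤ lam) (hlt : q < q')
    (hpos : 0 < 1 + lam * (1 - q')) : purchaseBoundary lam q < purchaseBoundary lam q' := by
  have h1 := mul_le_mul_of_nonneg_left (sub_le_sub_left hlt.le 1) hlam
  have h2 := mul_pos (sub_pos.2 hlt) (by linarith : 0 < 1 + lam)
  unfold purchaseBoundary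
  rw [div_lt_div_iff₀ (by linarith) hpos]
  linarith

theorem saleBoundary_lt {q q' : ℝ} (hgam : 0 ≤ gam) (hgam1 : gam < 1) (hq : 0 < q)
    (hlt : q < q') : saleBoundary gam q < saleBoundary gam q' := by
  have h1 := mul_nonneg hgam hq.le
  have h2 := mul_nonneg hgam (hq.trans hlt).le
  have h3 := mul_pos (sub_pos.2 hlt) (sub_pos.2 hgam1)
  unfold saleBoundary
  rw [div_lt_div_iff₀ (by linarith) (by linarith)]
  linarith

/-- Comparison of two solutions whose parameters `b₁` and `b₃` may differ. -/
theorem IsFreeBoundarySolution.boundaries_lt {R b₁ b₁' b₂ b₃ b₃' : ℝ} {n n' : ℝ → ℝ}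
    {qL qU qL' qU' : ℝ} (hlam : 0 ≤ lam) (hgam : 0 ≤ gam) (hgam1 : gam < 1)
    (hP : (AuxParams.mk R b₁ b₂ b₃).Valid) (hP' : (AuxParams.mk R b₁' b₂ b₃').Valid)
    (h : IsFreeBoundarySolution (AuxParams.mk R b₁ b₂ b₃) (roundTrip lam gam) n qL qU)
    (h' : IsFreeBoundarySolution (AuxParams.mk R b₁' b₂ b₃') (roundTrip lam gam) n' qL' qU')
    (hb₃ : b₃ ≤ b₃')
    (hσ : ∀ q w : ℝ, 0 < q → w < 0 → 0 < (b₁' - b₁) * w + (b₃' - b₃) * (1 - (1 - R) * q * w)) :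
    purchaseBoundary lam qL < purchaseBoundary lam qL' ∧
      saleBoundary gam qU < saleBoundary gam qU' := by
  obtain ⟨h1, h2⟩ :=
    (h.reduced hP).boundaries_lt (h'.reduced hP') hP.R_pos hP.β_pos hb₃ hσ
  exact ⟨purchaseBoundary_lt hlam h1 (h'.purchase_den_pos hP' hlam hgam hgam1),
    saleBoundary_lt hgam hgam1 (h.qL_pos.trans h.qL_lt_qU) h2⟩

end Boundaries

theorem theorem6p2 (lam gam : ℝ) (hlam : 0 ≤ lam) (hgam : 0 ≤ gam) (hgam1 : gam < 1)
    (hcost : 0 < lam + gam) :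
    (∀ (R b₁ b₁' b₂ b₃ : ℝ), (AuxParams.mk R b₁ b₂ b₃).Valid → (AuxParams.mk R b₁' b₂ b₃).Valid →
      b₁ < b₁' →
      ∀ (n n' : ℝ → ℝ) (qL qU qL' qU' : ℝ),
        IsFreeBoundarySolution (AuxParams.mk R b₁ b₂ b₃) (roundTrip lam gam) n qL qU →
        IsFreeBoundarySolution (AuxParams.mk R b₁' b₂ b₃) (roundTrip lam gam) n' qL' qU' →
        purchaseBoundary lam qL' < purchaseBoundary lam qL ∧
          saleBoundary gam qU' < saleBoundary gam qU) ∧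
    (∀ (R b₁ b₂ b₃ b₃' : ℝ), (AuxParams.mk R b₁ b₂ b₃).Valid → (AuxParams.mk R b₁ b₂ b₃').Valid →
      R < 1 → b₃ < b₃' →
      ∀ (n n' : ℝ → ℝ) (qL qU qL' qU' : ℝ),
        IsFreeBoundarySolution (AuxParams.mk R b₁ b₂ b₃) (roundTrip lam gam) n qL qU →
        IsFreeBoundarySolution (AuxParams.mk R b₁ b₂ b₃') (roundTrip lam gam) n' qL' qU' →
        purchaseBoundary lam qL < purchaseBoundary lam qL' ∧
          saleBoundary gam qU < saleBoundary gam qU') := by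

  constructor
  · intro R b₁ b₁' b₂ b₃ hP hP' hb n n' qL qU qL' qU' h h'
    refine h'.boundaries_lt hlam hgam hgam1 hP' hP h le_rfl fun q w _ hw => ?_
    rw [sub_self, zero_mul, add_zero]
    exact mul_pos_of_neg_of_neg (sub_neg.2 hb) hw
  · intro R b₁ b₂ b₃ b₃' hP hP' hR hb n n' qL qU qL' qU' h h'
    refine h.boundaries_lt hlam hgam hgam1 hP hP' h' hb.le fun q w hq hw => ?_
    rw [sub_self, zero_mul, zero_add]
    have := mul_neg_of_pos_of_neg (mul_pos (sub_pos.2 hR) hq) hw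
    exact mul_pos (sub_pos.2 hb) (by linarith)
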